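/- Fix a first-order language $\mathcal L$ with equality and with an infinite set $\mathit{Var}$ of variables. Expressions are terms of $\mathcal L$, Boolean expressions are quantifier-free formulas, assertions are formulas. Statements are given by $$S ::= skip \mid \bar x:=\bar t \mid P(\bar t) \mid S;S \mid \mathbf{if}\ B\ \mathbf{then}\ S\ \mathbf{else}\ S\ \mathbf{fi} \mid \mathbf{while}\ B\ \mathbf{do}\ S\ \mathbf{od} \mid \mathbf{begin\ local}\ \bar x:=\bar t;\ S\ \mathbf{end},$$ where $\bar x$ is a finite list of distinct variables and $\bar t$ a list of expressions of the same length. Fix a finite set $D=\{P_i(\bar u_i)::S_i \mid 1\le i\le n\}$ of (mutually recursive) procedure declarations, one for each procedure name, where the formal parameters $\bar u_i$ are distinct variables; calls have as many actual as formal parameters. Let $I$ be an interpretation of $\mathcal L$ with non-empty domain; a state $\sigma$ maps variables to domain elements. The meaning of a program $(D\mid S)$ is the usual input-output relation on states, where $\mathbf{begin\ local}\ \bar x:=\bar t;\ S\ \mathbf{end}$, started in $\sigma$, executes $\bar x:=\bar t;\ S$ and, on termination, resets $\bar x$ to $\sigma(\bar x)$, and a call $P(\bar t)$ with $P(\bar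 u)::S\in D$ is executed as $\mathbf{begin\ local}\ \bar u:=\bar t;\ S\ \mathbf{end}$. Let $sp_I(p,S)$ be the set of final states of executions of $(D\mid S)$ from states satisfying $p$. Write $I\models\{p\}S\{q\}$ if every state in $sp_I(p,S)$ satisfies $q$. Call $\mathcal L$ expressive relative to $I$ (for $D$) if for every assertion $p$ and statement $S$ some formula of $\mathcal L$ is true in exactly the states of $sp_I(p,S)$. Let $var(D\mid S)$ be the set of variables occurring in $D$ or $S$. Let $change(D\mid S)$ be defined by: $\emptyset$ for $skip$; $\{\bar x\}$ for $\bar x:=\bar t$; the union over the immediate components for composition, conditional and loop; $change(D\mid S)\setminus\{\bar x\}$ for the block above; and $change(D)\setminus\{\bar u\}$ for a call $P(\bar t)$ with $P(\bar u)::S\in D$. Here $change(D)=\bigcup_i change(\emptyset\mid S_i)$, calls contributing $\emptyset$ to $change(\emptyset\mid\cdot)$. Substitution in assertions is simultaneous and capture-avoiding. The proof system CBV has the following axioms and rules: - SKIP: $\{p\}\,skip\,\{p\}$. - ASSIGNMENT: $\{p[\bar x:=\bar t]\}\ \bar x:=\bar t\ \{p\}$. - COMPOSITION: from $\{p\}S_1\{r\}$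 and $\{r\}S_2\{q\}$ infer $\{p\}S_1;S_2\{q\}$. - CONDITIONAL: from $\{p\wedge B\}S_1\{q\}$ and $\{p\wedge\neg B\}S_2\{q\}$ infer $\{p\}\mathbf{if}\ B\ \mathbf{then}\ S_1\ \mathbf{else}\ S_2\ \mathbf{fi}\{q\}$. - LOOP: from $\{p\wedge B\}S\{p\}$ infer $\{p\}\mathbf{while}\ B\ \mathbf{do}\ S\ \mathbf{od}\{p\wedge\neg B\}$. - BLOCK: from $\{p\}\bar x:=\bar t;S\{q\}$ infer $\{p\}\mathbf{begin\ local}\ \bar x:=\bar t;S\ \mathbf{end}\{q\}$, if $\{\bar x\}\cap free(q)=\emptyset$. - PROCEDURE CALL: from $\{p\}P(\bar u)\{q\}$ infer $\{p[\bar u:=\bar t]\}P(\bar t)\{q\}$, if $P(\bar u)::S\in D$ for some $S$ and $\{\bar u\}\cap free(q)=\emptyset$. - SUBSTITUTION: from $\{p\}S\{q\}$ infer $\{p[\bar x:=\bar y]\}S\{q[\bar x:=\bar y]\}$, for a list $\bar y$ of variables, if $\{\bar x\}\cap var(D\mid S)=\emptyset$ and $\{\bar y\}\cap change(D\mid S)=\emptyset$.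 - INVARIANCE: from $\{r\}S\{q\}$ infer $\{p\wedge r\}S\{p\wedge q\}$, if $free(p)\cap change(D\mid S)=\emptyset$. - $\exists$-INTRODUCTION: from $\{p\}S\{q\}$ infer $\{\exists\bar x:p\}S\{q\}$, if $\{\bar x\}\cap(var(D\mid S)\cup free(q))=\emptyset$. - CONSEQUENCE: from $\{p_1\}S\{q_1\}$ infer $\{p\}S\{q\}$, if $p\to p_1$ and $q_1\to q$ are true in $I$. - RECURSION: infer $\{p\}S\{q\}$ if there are assertions $p_i,q_i$ with $\{\bar u_i\}\cap free(q_i)=\emptyset$ ($1\le i\le n$) such that $\{p\}S\{q\}$ and all $\{p_i\}S_i\{q_i\}$ ($1\le i\le n$) are provable from the assumptions $\{p_1\}P_1(\bar u_1)\{q_1\},\dots,\{p_n\}P_n(\bar u_n)\{q_n\}$ by the other axioms and rules. Write $\vdash_I\{p\}S\{q\}$ if $\{p\}S\{q\}$ is provable in CBV, using the assertions true in $I$ in CONSEQUENCE. **Theorem (Completeness).** CBV is complete in the sense of Cook: for every interpretation $I$ such that $\mathcal L$ is expressive relative to $I$ and every correctness formula $\{p\}S\{q\}$, if $I\models\{p\}S\{q\}$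 then $\vdash_I\{p\}S\{q\}$. -/

import Mathlib

universe u v w x y

namespace CBV

noncomputable section

/-! ### Assertions

Expressions are the terms `L.Term V` of a first-order language `L` (with equality) over the set of
variables `V`, assertions are the formulas `L.Formula V`, and Boolean expressions are the
quantifier-free formulas. Lists of distinct variables are embeddings `Fin n ↪ V`. Bound variables
of Mathlib formulas are nameless, so the elements of `V` that occur in a formula are exactly its
free variables and substitution cannot capture variables. -/

section Assertions

variable {L : FirstOrder.Language.{u, v}} {V : Type w}

/-- `[x̄ := t̄]` as a map from variables to expressions: `x i` goes to `t i`, every other variable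
to itself. -/
def substMap {n : ℕ} (xs : Fin n ↪ V) (t : Fin n → L.Term V) : V → L.Term V :=
  Function.extend xs t FirstOrder.Language.Term.var

/-- The result `p[x̄ := t̄]` of the simultaneous substitution of `t̄` for `x̄` in `p`. -/
def subst {n : ℕ} (p : L.Formula V) (xs : Fin n ↪ V) (t : Fin n → L.Term V) : L.Formula V :=
  FirstOrder.Language.BoundedFormula.subst p (substMap xs t)

/-- The assertion `∃ x̄ : p`. -/
def existsVars {n : ℕ} (xs : Fin n ↪ V) (p : L.Formula V) : L.Formula V :=
  FirstOrder.Language.BoundedFormula.exs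
    (FirstOrder.Language.BoundedFormula.relabel (n := n) (k := 0) (Function.extend xs Sum.inr Sum.inl) p)

/-- `free(p)`. -/
def free [DecidableEq V] (p : L.Formula V) : Set V :=
  ↑(FirstOrder.Language.BoundedFormula.freeVarFinset p)

/-- The variables that occur in a list of expressions. -/
def termVars [DecidableEq V] {n : ℕ} (t : Fin n → L.Term V) : Set V :=
  ⋃ i, ↑(t i).varFinset

end Assertions

/-! ### Programs -/

/-- Statements over procedure names `Proc`, where the procedure `P` has `ar P` parameters. -/
inductive Stmt (L : FirstOrder.Language.{u, v}) (V : Type w) {Proc : Type x} (ar : Proc → ℕ) :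
    Type (max u v w x)
  | skip : Stmt L V ar
  /-- the parallel assignment `x̄ := t̄` -/
  | assign {n : ℕ} (xs : Fin n ↪ V) (t : Fin n → L.Term V) : Stmt L V ar
  /-- the procedure call `P(t̄)` -/
  | call (P : Proc) (t : Fin (ar P) → L.Term V) : Stmt L V ar
  | seq (S₁ S₂ : Stmt L V ar) : Stmt L V ar
  | cond (B : L.Formula V) (hB : FirstOrder.Language.BoundedFormula.IsQF B) (S₁ S₂ : Stmt L V ar) :
      Stmt L V ar
  | loop (B : L.Formula V) (hB : FirstOrder.Language.BoundedFormula.IsQF B) (S : Stmt L V ar) : Stmt L V ar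
  /-- the block statement `begin local x̄ := t̄; S end` -/
  | block {n : ℕ} (xs : Fin n ↪ V) (t : Fin n → L.Term V) (S : Stmt L V ar) : Stmt L V ar

/-- A system of (mutually recursive) procedure declarations, with exactly one declaration
`P(ū) :: S` for every procedure name `P`. -/
structure Decls (L : FirstOrder.Language.{u, v}) (V : Type w) {Proc : Type x} (ar : Proc → ℕ) where
  /-- the formal parameters -/
  formals : (P : Proc) → Fin (ar P) ↪ V
  /-- the procedure bodies -/
  body : Proc → Stmt L V ar

section Programs

variable {L : FirstOrder.Language.{u, v}} {V : Type w} {Proc : Type x} {ar : Proc → ℕ}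

/-- The generic call `P(ū)`, where `ū` are the formal parameters of `P`. -/
def genericCall (D : Decls L V ar) (P : Proc) : Stmt L V ar :=
  Stmt.call P fun i => FirstOrder.Language.Term.var (D.formals P i)

/-- The variables that occur in a statement. -/
def Stmt.vars [DecidableEq V] : Stmt L V ar → Set V
  | .skip => ∅
  | .assign xs t => Set.range xs ∪ termVars t
  | .call _ t => termVars t
  | .seq S₁ S₂ => S₁.vars ∪ S₂.vars
  | .cond B _ S₁ S₂ => free B ∪ S₁.vars ∪ S₂.vars
  | .loop B _ S => free B ∪ S.vars
  | .block xs t S => Set.range xs ∪ termVars t ∪ S.vars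

/-- `var(D | S)`, the set of variables that occur in the program `(D | S)`. -/
def progVars [DecidableEq V] (D : Decls L V ar) (S : Stmt L V ar) : Set V :=
  (⋃ P, Set.range (D.formals P) ∪ (D.body P).vars) ∪ S.vars

/-- The variables that can be changed by a statement, given for each procedure the set of variables
that can be changed by a call of it. -/
def Stmt.changeWith (c : Proc → Set V) : Stmt L V ar → Set V
  | .skip => ∅
  | .assign xs _ => Set.range xs
  | .call P _ => c P
  | .seq S₁ S₂ => S₁.changeWith c ∪ S₂.changeWith c
  | .cond _ _ S₁ S₂ => S₁.changeWith c ∪ S₂.changeWith c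
  | .loop _ _ S => S.changeWith c
  | .block xs _ S => S.changeWith c \ Set.range xs

/-- `change(D)`, the union over all declarations `P(ū) :: S` in `D` of `change(∅ | S)`, in which
procedure calls contribute nothing. -/
def changeDecls (D : Decls L V ar) : Set V :=
  ⋃ P, (D.body P).changeWith fun _ => ∅

/-- `change(D | S)`, where `change(D | P(t̄)) = change(D) \ {ū}` for `P(ū) :: S` in `D`. -/
def change (D : Decls L V ar) (S : Stmt L V ar) : Set V :=
  S.changeWith fun P => changeDecls D \ Set.range (D.formals P)

end Programs

/-! ### Semantics -/

section Semantics

variable {L : FirstOrder.Language.{u, v}} {V : Type w} {Proc : Type x} {ar : Proc → ℕ}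
variable {M : Type y}

/-- The update `σ[x̄ := d̄]` of a state `σ`. -/
def update {n : ℕ} (σ : V → M) (xs : Fin n ↪ V) (d : Fin n → M) : V → M :=
  Function.extend xs d σ

variable [L.Structure M]

/-- `Exec D S σ τ`: the program `(D | S)`, started in the state `σ`, terminates in the state `τ`.
A procedure call is executed as the block that results from inlining. -/
inductive Exec (D : Decls L V ar) : Stmt L V ar → (V → M) → (V → M) → Prop
  | skip (σ : V → M) : Exec D .skip σ σ
  | assign {n : ℕ} (xs : Fin n ↪ V) (t : Fin n → L.Term V) (σ : V → M) :
      Exec D (.assign xs t) σ (update σ xs fun i => (t i).realize σ)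
  | call {P : Proc} {t : Fin (ar P) → L.Term V} {σ τ : V → M} :
      Exec D (.block (D.formals P) t (D.body P)) σ τ → Exec D (.call P t) σ τ
  | seq {S₁ S₂ : Stmt L V ar} {σ ρ τ : V → M} :
      Exec D S₁ σ ρ → Exec D S₂ ρ τ → Exec D (.seq S₁ S₂) σ τ
  | condTrue {B : L.Formula V} {hB : FirstOrder.Language.BoundedFormula.IsQF B} {S₁ S₂ : Stmt L V ar}
      {σ τ : V → M} : B.Realize σ → Exec D S₁ σ τ → Exec D (.cond B hB S₁ S₂) σ τ
  | condFalse {B : L.Formula V} {hB : FirstOrder.Language.BoundedFormula.IsQF B} {S₁ S₂ : Stmt L V ar}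
      {σ τ : V → M} : ¬ B.Realize σ → Exec D S₂ σ τ → Exec D (.cond B hB S₁ S₂) σ τ
  | loopTrue {B : L.Formula V} {hB : FirstOrder.Language.BoundedFormula.IsQF B} {S : Stmt L V ar}
      {σ ρ τ : V → M} :
      B.Realize σ → Exec D S σ ρ → Exec D (.loop B hB S) ρ τ → Exec D (.loop B hB S) σ τ
  | loopFalse {B : L.Formula V} {hB : FirstOrder.Language.BoundedFormula.IsQF B} {S : Stmt L V ar}
      {σ : V → M} : ¬ B.Realize σ → Exec D (.loop B hB S) σ σ
  | block {n : ℕ} {xs : Fin n ↪ V} {t : Fin n → L.Term V} {S : Stmt L V ar} {σ τ : V → M} :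
      Exec D (.seq (.assign xs t) S) σ τ →
        Exec D (.block xs t S) σ (update τ xs fun i => σ (xs i))

/-- The meaning `⟦p⟧` of an assertion: the set of states in which it is true. -/
def meaning (M : Type y) [L.Structure M] (p : L.Formula V) : Set (V → M) :=
  {σ | p.Realize σ}

/-- The assertion `p` is true in the interpretation with domain `M`. -/
def TrueIn (M : Type y) [L.Structure M] (p : L.Formula V) : Prop :=
  meaning M p = Set.univ

/-- The strongest postcondition of `(D | S)` with respect to `p`: the set of states that can be
reached by executing `(D | S)` from a state that satisfies `p`. -/
def sp (M : Type y) [L.Structure M] (D : Decls L V ar) (p : L.Formula V) (S : Stmt L V ar) :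
    Set (V → M) :=
  {τ | ∃ σ ∈ meaning M p, Exec D S σ τ}

/-- The language is expressive relative to the interpretation with domain `M`, for programs with
declarations `D`: all strongest postconditions are definable. -/
def Expressive (M : Type y) [L.Structure M] (D : Decls L V ar) : Prop :=
  ∀ (p : L.Formula V) (S : Stmt L V ar), ∃ φ : L.Formula V, meaning M φ = sp M D p S

end Semantics

/-! ### Correctness formulas and the proof system -/

/-- A correctness formula `{p} S {q}`. -/
structure Triple (L : FirstOrder.Language.{u, v}) (V : Type w) {Proc : Type x} (ar : Proc → ℕ) where
  /-- the precondition -/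
  pre : L.Formula V
  /-- the statement -/
  stmt : Stmt L V ar
  /-- the postcondition -/
  post : L.Formula V

section ProofSystem

variable {L : FirstOrder.Language.{u, v}} {V : Type w} {Proc : Type x} {ar : Proc → ℕ}

/-- `{p} S {q}` is true in the interpretation with domain `M`, in the sense of partial
correctness. -/
def Valid (M : Type y) [L.Structure M] (D : Decls L V ar) (f : Triple L V ar) : Prop :=
  sp M D f.pre f.stmt ⊆ meaning M f.post

variable [DecidableEq V]

/-- Provability from the set `Φ` of correctness formulas, and from all assertions that are true in
the interpretation with domain `M`, by all axioms and rules of CBV except RECURSION. -/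
inductive DerivesBasic (M : Type y) [L.Structure M] (D : Decls L V ar) (Φ : Set (Triple L V ar)) :
    Triple L V ar → Prop
  | hyp {f : Triple L V ar} : f ∈ Φ → DerivesBasic M D Φ f
  | skip (p : L.Formula V) : DerivesBasic M D Φ ⟨p, .skip, p⟩
  | assign {n : ℕ} (xs : Fin n ↪ V) (t : Fin n → L.Term V) (p : L.Formula V) :
      DerivesBasic M D Φ ⟨subst p xs t, .assign xs t, p⟩
  | seq {p r q : L.Formula V} {S₁ S₂ : Stmt L V ar} :
      DerivesBasic M D Φ ⟨p, S₁, r⟩ → DerivesBasic M D Φ ⟨r, S₂, q⟩ →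
        DerivesBasic M D Φ ⟨p, .seq S₁ S₂, q⟩
  | cond {p q B : L.Formula V} {hB : FirstOrder.Language.BoundedFormula.IsQF B} {S₁ S₂ : Stmt L V ar} :
      DerivesBasic M D Φ ⟨p ⊓ B, S₁, q⟩ → DerivesBasic M D Φ ⟨p ⊓ B.not, S₂, q⟩ →
        DerivesBasic M D Φ ⟨p, .cond B hB S₁ S₂, q⟩
  | loop {p B : L.Formula V} {hB : FirstOrder.Language.BoundedFormula.IsQF B} {S : Stmt L V ar} :
      DerivesBasic M D Φ ⟨p ⊓ B, S, p⟩ → DerivesBasic M D Φ ⟨p, .loop B hB S, p ⊓ B.not⟩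
  | procedureCall {p q : L.Formula V} {P : Proc} (t : Fin (ar P) → L.Term V) :
      Disjoint (Set.range (D.formals P)) (free q) →
      DerivesBasic M D Φ ⟨p, genericCall D P, q⟩ →
        DerivesBasic M D Φ ⟨subst p (D.formals P) t, .call P t, q⟩
  | block {n : ℕ} {xs : Fin n ↪ V} {t : Fin n → L.Term V} {S : Stmt L V ar} {p q : L.Formula V} :
      Disjoint (Set.range xs) (free q) →
      DerivesBasic M D Φ ⟨p, .seq (.assign xs t) S, q⟩ →
        DerivesBasic M D Φ ⟨p, .block xs t S, q⟩
  | substitution {n : ℕ} (xs : Fin n ↪ V) (ys : Fin n → V) {p q : L.Formula V}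
      {S : Stmt L V ar} :
      Disjoint (Set.range xs) (progVars D S) → Disjoint (Set.range ys) (change D S) →
      DerivesBasic M D Φ ⟨p, S, q⟩ →
        DerivesBasic M D Φ ⟨subst p xs fun i => FirstOrder.Language.Term.var (ys i), S,
          subst q xs fun i => FirstOrder.Language.Term.var (ys i)⟩
  | invariance (p : L.Formula V) {r q : L.Formula V} {S : Stmt L V ar} :
      Disjoint (free p) (change D S) →
      DerivesBasic M D Φ ⟨r, S, q⟩ → DerivesBasic M D Φ ⟨p ⊓ r, S, p ⊓ q⟩
  | existsIntro {n : ℕ} (xs : Fin n ↪ V) {p q : L.Formula V} {S : Stmt L V ar} :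
      Disjoint (Set.range xs) (progVars D S ∪ free q) →
      DerivesBasic M D Φ ⟨p, S, q⟩ → DerivesBasic M D Φ ⟨existsVars xs p, S, q⟩
  | consequence {p p₁ q₁ q : L.Formula V} {S : Stmt L V ar} :
      TrueIn M (p.imp p₁) → DerivesBasic M D Φ ⟨p₁, S, q₁⟩ → TrueIn M (q₁.imp q) →
        DerivesBasic M D Φ ⟨p, S, q⟩

/-- `f` is the conclusion of an application of the RECURSION rule: for some specifications
`{p i} P i (ū i) {q i}` of the generic calls of all the declared procedures, where `ū i` is not free
in `q i`, the formula `f` and the formulas `{p i} S i {q i}` for the procedure bodies `S i` are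
provable from these specifications by the remaining axioms and rules. -/
def RecursionConclusion (M : Type y) [L.Structure M] (D : Decls L V ar) (f : Triple L V ar) :
    Prop :=
  ∃ p q : Proc → L.Formula V,
    (∀ i, Disjoint (Set.range (D.formals i)) (free (q i))) ∧
    DerivesBasic M D (Set.range fun i => ⟨p i, genericCall D i, q i⟩) f ∧
    ∀ i, DerivesBasic M D (Set.range fun j => ⟨p j, genericCall D j, q j⟩) ⟨p i, D.body i, q i⟩

/-- `Φ ⊢_I f`: provability in the system CBV (including the RECURSION rule) from the set `Φ` of
correctness formulas and all assertions true in the interpretation with domain `M`. -/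
def Derives (M : Type y) [L.Structure M] (D : Decls L V ar) (Φ : Set (Triple L V ar))
    (f : Triple L V ar) : Prop :=
  DerivesBasic M D (Φ ∪ {g | RecursionConclusion M D g}) f

end ProofSystem

end

end CBV

/-! The argument rests on most general correctness formulas. Let `xs` list the variables of the
declarations and let `fr` supply fresh copies of them. The formula `{xs = fr xs} P(ū) {φ}`, with `φ`
the strongest postcondition, records the whole input-output behaviour of `P`: the copies remember
the initial state. As a call restores `ū`, replacing `ū` by its copies in `φ` loses nothing; the
resulting postcondition is free of `ū`, as RECURSION demands, and is already true of the body of `P`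
(`valid_body_genericPost`).

From these formulas as assumptions, every true formula for a call is derivable
(`derivesBasic_call`). Structural induction on statements extends this to every true formula
(`derivesBasic_of_valid`), in particular to those for the bodies, so one application of RECURSION
discharges the assumptions.

Two cases of the induction need an idea. For loops, the set of reachable loop-head states is an
invariant, and it is definable because a loop whose guard also stops it at a state stored in fresh
variables is again a statement (`exists_definable_loopReach`). For blocks, fresh variables keep the
values that the block restores (`derivesBasic_block`). In all cases the fresh variables are finally
removed by ∃-INTRODUCTION, and the semantic input is that a run depends only on the variables of the
program and alters only those in `change`. -/

namespace CBV

open FirstOrder.Language Set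

/-! ### Fresh variables, substitution and free variables -/

section FormulaLemmas

variable {L : FirstOrder.Language.{u, v}} {V : Type w} {M : Type y}

@[simp]
theorem update_apply_mem {n : ℕ} (σ : V → M) (xs : Fin n ↪ V) (d : Fin n → M) (i : Fin n) :
    update σ xs d (xs i) = d i :=
  xs.injective.extend_apply d σ i

theorem update_of_notMem {n : ℕ} (σ : V → M) (xs : Fin n ↪ V) (d : Fin n → M) {a : V}
    (ha : a ∉ range xs) : update σ xs d a = σ a :=
  Function.extend_apply' d σ a ha

theorem update_self {n : ℕ} (σ : V → M) (xs : Fin n ↪ V) : update σ xs (fun i => σ (xs i)) = σ := by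
  funext a
  by_cases ha : a ∈ range xs
  · obtain ⟨i, rfl⟩ := ha
    simp
  · exact update_of_notMem _ _ _ ha

theorem exists_enumeration {A : Set V} (hA : A.Finite) : ∃ (n : ℕ) (xs : Fin n ↪ V), range xs = A := by
  have := hA.to_subtype
  let e := Finite.equivFin A
  refine ⟨_, e.symm.toEmbedding.trans (Function.Embedding.subtype _), ?_⟩
  ext a
  constructor
  · rintro ⟨i, rfl⟩
    exact (e.symm i).2
  · intro ha
    exact ⟨e ⟨a, ha⟩, congrArg Subtype.val (e.symm_apply_apply ⟨a, ha⟩)⟩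

/-- Removing finitely many elements does not change the cardinality of an infinite set. A single map
then gives fresh copies of any list of variables by composition. -/
theorem exists_fresh_embedding [Infinite V] {A : Set V} (hA : A.Finite) :
    ∃ fr : V ↪ V, Disjoint (range fr) A := by
  have h := Cardinal.mk_compl_finset_of_infinite hA.toFinset
  obtain ⟨e⟩ := Cardinal.eq.1 h
  refine ⟨e.symm.toEmbedding.trans (Function.Embedding.subtype _), ?_⟩
  rw [Set.disjoint_left]
  rintro _ ⟨a, rfl⟩ ha
  have := (e.symm a).2
  simp at this
  exact this ha

/-- The assertion that `x = f x` for all `x` in `x̄`. -/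
noncomputable def eqs (L : FirstOrder.Language.{u, v}) {n : ℕ} (xs : Fin n ↪ V) (f : V → V) :
    L.Formula V :=
  Formula.iInf fun i => Term.equal (.var (xs i)) (.var (f (xs i)))

theorem isQF_eqs {n : ℕ} (xs : Fin n ↪ V) (f : V → V) : BoundedFormula.IsQF (eqs L xs f) := by
  unfold eqs Formula.iInf BoundedFormula.iInf
  have : ∀ l : List (L.Formula V), (∀ φ ∈ l, BoundedFormula.IsQF φ) →
      BoundedFormula.IsQF (l.foldr (· ⊓ ·) (⊤ : L.BoundedFormula V 0)) := by
    intro l hl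
    induction l with
    | nil => exact BoundedFormula.IsQF.top
    | cons a l ih =>
      exact BoundedFormula.IsQF.inf (hl a (by simp)) (ih fun φ h => hl φ (by simp [h]))
  apply this
  intro φ hφ
  obtain ⟨i, -, rfl⟩ := List.mem_map.1 hφ
  exact (BoundedFormula.IsAtomic.equal _ _).isQF

theorem varFinsetLeft_subst [DecidableEq V] {n : ℕ} (t : L.Term (V ⊕ Fin n)) (f : V → L.Term V) :
    ((t.subst (Sum.elim (Term.relabel Sum.inl ∘ f) (Term.var ∘ Sum.inr))).varFinsetLeft : Set V) ⊆
      ⋃ a ∈ t.varFinsetLeft, ((f a).varFinset : Set V) := by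
  have key : ∀ s : L.Term V,
      (s.relabel (Sum.inl : V → V ⊕ Fin n)).varFinsetLeft = s.varFinset := by
    intro s
    induction s with
    | var => rfl
    | func g ts ih => simp [ih]
  induction t with
  | var a => cases a <;> simp [key]
  | func g ts ih =>
    intro b hb
    simp only [Term.subst, Term.varFinsetLeft, Finset.coe_biUnion, mem_iUnion] at hb ⊢
    obtain ⟨i, hi, hb⟩ := hb
    obtain ⟨a, ha, hb⟩ := mem_iUnion₂.1 (ih i hb)
    exact ⟨a, Finset.mem_biUnion.2 ⟨i, by simp, ha⟩, hb⟩

theorem freeVarFinset_subst [DecidableEq V] {n : ℕ} (φ : L.BoundedFormula V n) (f : V → L.Term V) :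
    ((φ.subst f).freeVarFinset : Set V) ⊆ ⋃ a ∈ φ.freeVarFinset, ((f a).varFinset : Set V) := by
  induction φ with
  | falsum => simp [BoundedFormula.subst, BoundedFormula.mapTermRel]
  | equal t₁ t₂ =>
    have h₁ := varFinsetLeft_subst t₁ f
    have h₂ := varFinsetLeft_subst t₂ f
    simp only [BoundedFormula.subst, BoundedFormula.mapTermRel, BoundedFormula.freeVarFinset,
      Finset.coe_union]
    exact union_subset (h₁.trans (biUnion_subset_biUnion_left fun a => Finset.mem_union_left _))
      (h₂.trans (biUnion_subset_biUnion_left fun a => Finset.mem_union_right _))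
  | rel R ts =>
    intro b hb
    simp only [BoundedFormula.subst, BoundedFormula.mapTermRel, BoundedFormula.freeVarFinset,
      Finset.coe_biUnion, mem_iUnion] at hb ⊢
    obtain ⟨i, hi, hb⟩ := hb
    obtain ⟨a, ha, hb⟩ := mem_iUnion₂.1 (varFinsetLeft_subst (ts i) f hb)
    exact ⟨a, Finset.mem_biUnion.2 ⟨i, by simp, ha⟩, hb⟩
  | imp φ ψ h₁ h₂ =>
    change ((((φ.subst f).freeVarFinset ∪ (ψ.subst f).freeVarFinset : Finset V)) : Set V) ⊆ _
    rw [Finset.coe_union]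
    exact union_subset
      (h₁.trans (biUnion_subset_biUnion_left fun a ha => Finset.mem_union_left _ ha))
      (h₂.trans (biUnion_subset_biUnion_left fun a ha => Finset.mem_union_right _ ha))
  | all φ h => exact h

section Realize

variable [L.Structure M]

@[simp]
theorem realize_eqs {n : ℕ} (xs : Fin n ↪ V) (f : V → V) {σ : V → M} :
    (eqs L xs f).Realize σ ↔ ∀ i, σ (xs i) = σ (f (xs i)) := by
  simp [eqs]

theorem realize_subst {n : ℕ} (p : L.Formula V) (xs : Fin n ↪ V) (t : Fin n → L.Term V)
    {σ : V → M} :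
    (subst p xs t).Realize σ ↔ p.Realize (update σ xs fun i => (t i).realize σ) := by
  have : (fun a => (substMap xs t a).realize σ) = update σ xs fun i => (t i).realize σ := by
    funext a
    by_cases ha : a ∈ range xs
    · obtain ⟨i, rfl⟩ := ha
      rw [substMap, xs.injective.extend_apply, update_apply_mem]
    · rw [substMap, Function.extend_apply' _ _ _ ha, update_of_notMem _ _ _ ha, Term.realize_var]
  rw [Formula.Realize, subst, BoundedFormula.realize_subst, this, Formula.Realize]

theorem realize_existsVars {n : ℕ} (xs : Fin n ↪ V) (p : L.Formula V) {σ : V → M} :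
    (existsVars xs p).Realize σ ↔ ∃ d, p.Realize (update σ xs d) := by
  have (d : Fin n → M) :
      Sum.elim σ (d ∘ Fin.castAdd 0) ∘ Function.extend xs Sum.inr Sum.inl = update σ xs d := by
    funext a
    by_cases ha : a ∈ range xs
    · obtain ⟨i, rfl⟩ := ha
      simp [xs.injective.extend_apply]
    · rw [Function.comp_apply, Function.extend_apply' _ _ _ ha, update_of_notMem _ _ _ ha]
      rfl
  rw [existsVars, BoundedFormula.realize_exs]
  refine exists_congr fun d => ?_
  rw [BoundedFormula.realize_relabel, this, Formula.Realize, Subsingleton.elim (d ∘ _) default]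

end Realize

variable [DecidableEq V]

theorem free_subst {n : ℕ} (p : L.Formula V) (xs : Fin n ↪ V) (t : Fin n → L.Term V) :
    free (subst p xs t) ⊆ (free p \ range xs) ∪ termVars t := by
  intro b hb
  obtain ⟨a, ha, hb⟩ := mem_iUnion₂.1 (freeVarFinset_subst p _ hb)
  by_cases hax : a ∈ range xs
  · obtain ⟨i, rfl⟩ := hax
    rw [substMap, xs.injective.extend_apply] at hb
    exact Or.inr (mem_iUnion.2 ⟨i, hb⟩)
  · rw [substMap, Function.extend_apply' _ _ _ hax] at hb
    simp only [Term.varFinset, Finset.coe_singleton, mem_singleton_iff] at hb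
    subst hb
    exact Or.inl ⟨ha, hax⟩

theorem termVars_var {n : ℕ} (ys : Fin n → V) :
    termVars (fun i => (Term.var (ys i) : L.Term V)) = range ys := by
  ext a
  simp [termVars, eq_comm]

theorem free_inf (p q : L.Formula V) : free (p ⊓ q) = free p ∪ free q := by
  change (((p.freeVarFinset ∪ (q.freeVarFinset ∪ ∅)) ∪ ∅ : Finset V) : Set V) = _
  simp [free]

theorem free_eqs {n : ℕ} (xs : Fin n ↪ V) (f : V → V) :
    free (eqs L xs f) ⊆ range xs ∪ f '' range xs := by
  unfold eqs Formula.iInf BoundedFormula.iInf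
  have : ∀ l : List (L.Formula V), (∀ φ ∈ l, free φ ⊆ range xs ∪ f '' range xs) →
      free (l.foldr (· ⊓ ·) (⊤ : L.BoundedFormula V 0)) ⊆ range xs ∪ f '' range xs := by
    intro l hl
    induction l with
    | nil => intro a ha; exact absurd ha (by simp [free])
    | cons a l ih =>
      rw [List.foldr_cons, free_inf]
      exact union_subset (hl a (by simp)) (ih fun φ h => hl φ (by simp [h]))
  apply this
  intro φ hφ
  obtain ⟨i, -, rfl⟩ := List.mem_map.1 hφ
  intro a ha
  have : a = xs i ∨ a = f (xs i) := by
    simpa [free, Term.equal, Term.bdEqual, BoundedFormula.freeVarFinset] using ha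
  rcases this with rfl | rfl
  · exact Or.inl ⟨i, rfl⟩
  · exact Or.inr ⟨_, ⟨i, rfl⟩, rfl⟩

theorem free_finite (p : L.Formula V) : (free p).Finite := Finset.finite_toSet _

theorem termVars_finite {n : ℕ} (t : Fin n → L.Term V) : (termVars t).Finite :=
  Set.finite_iUnion fun _ => Finset.finite_toSet _

variable [L.Structure M]

theorem realize_congr_of_eqOn_free {p : L.Formula V} {σ σ' : V → M} (h : EqOn σ σ' (free p)) :
    p.Realize σ ↔ p.Realize σ' := by
  unfold Formula.Realize
  rw [← BoundedFormula.realize_restrictFreeVar (f := id) (v := fun a => σ a) σ fun a => rfl,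
    ← BoundedFormula.realize_restrictFreeVar (f := id) (v := fun a => σ a) σ' fun a => h a.2]

theorem term_realize_congr {t : L.Term V} {σ σ' : V → M} (h : EqOn σ σ' t.varFinset) :
    t.realize σ = t.realize σ' := by
  rw [← Term.realize_restrictVar (f := id) (v := fun a => σ a) σ fun a => rfl,
    ← Term.realize_restrictVar (f := id) (v := fun a => σ a) σ' fun a => h a.2]

end FormulaLemmas

/-! ### Frame and coincidence properties of executions -/

section ProgramLemmas

variable {L : FirstOrder.Language.{u, v}} {V : Type w} {Proc : Type x} {ar : Proc → ℕ} {M : Type y}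

theorem update_eqOn {n : ℕ} {σ σ' : V → M} {xs : Fin n ↪ V} {d d' : Fin n → M} {X : Set V}
    (h : EqOn σ σ' X) (hd : d = d') : EqOn (update σ xs d) (update σ' xs d') X := by
  subst hd
  intro a ha
  by_cases hax : a ∈ range xs
  · obtain ⟨i, rfl⟩ := hax
    simp
  · rw [update_of_notMem _ _ _ hax, update_of_notMem _ _ _ hax, h ha]

theorem changeWith_subset_union (c : Proc → Set V) (S : Stmt L V ar) :
    S.changeWith c ⊆ S.changeWith (fun _ => ∅) ∪ ⋃ P, c P := by
  induction S with
  | skip => exact subset_union_left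
  | assign xs t => exact subset_union_left
  | call P t => exact (subset_iUnion c P).trans subset_union_right
  | seq S₁ S₂ h₁ h₂ =>
    rintro a (ha | ha)
    · exact (h₁ ha).imp_left Or.inl
    · exact (h₂ ha).imp_left Or.inr
  | cond B hB S₁ S₂ h₁ h₂ =>
    rintro a (ha | ha)
    · exact (h₁ ha).imp_left Or.inl
    · exact (h₂ ha).imp_left Or.inr
  | loop B hB S h => exact h
  | block xs t S h =>
    rintro a ⟨ha, hax⟩
    exact (h ha).imp_left fun h => ⟨h, hax⟩

/-- Nested calls contribute only subsets of `changeDecls D`, which already collects the changes of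
all bodies. Hence no fixed-point iteration is needed for the frame property of recursive calls. -/
theorem change_body_subset (D : Decls L V ar) (P : Proc) : change D (D.body P) ⊆ changeDecls D :=
  (changeWith_subset_union _ _).trans <| union_subset
    (subset_iUnion (fun P => (D.body P).changeWith fun _ => ∅) P) (iUnion_subset fun _ => sdiff_subset)

theorem Exec.eq_of_notMem_change [L.Structure M] {D : Decls L V ar} {S : Stmt L V ar}
    {σ τ : V → M} (h : Exec D S σ τ) :
    ∀ a ∉ change D S, τ a = σ a := by
  induction h with
  | skip => exact fun _ _ => rfl
  | assign xs t σ => exact fun a ha => update_of_notMem _ _ _ ha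
  | call h ih =>
    exact fun a ha => ih a fun h => ha ⟨change_body_subset D _ h.1, h.2⟩
  | seq h₁ h₂ ih₁ ih₂ =>
    exact fun a ha => (ih₂ a fun h => ha (Or.inr h)).trans (ih₁ a fun h => ha (Or.inl h))
  | condTrue hB h ih => exact fun a ha => ih a fun h => ha (Or.inl h)
  | condFalse hB h ih => exact fun a ha => ih a fun h => ha (Or.inr h)
  | loopTrue hB h₁ h₂ ih₁ ih₂ => exact fun a ha => (ih₂ a ha).trans (ih₁ a ha)
  | loopFalse => exact fun _ _ => rfl
  | @block n xs t S σ τ h ih =>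
    intro a ha
    by_cases hax : a ∈ range xs
    · obtain ⟨i, rfl⟩ := hax
      simp
    · rw [update_of_notMem _ _ _ hax]
      exact ih a fun h => ha ⟨h.resolve_left hax, hax⟩

variable [DecidableEq V]

theorem changeWith_empty_subset_vars (S : Stmt L V ar) :
    S.changeWith (fun _ => ∅) ⊆ S.vars := by
  induction S with
  | skip => exact Subset.rfl
  | assign xs t => exact subset_union_left
  | call P t => exact empty_subset _
  | seq S₁ S₂ h₁ h₂ => exact union_subset_union h₁ h₂
  | cond B hB S₁ S₂ h₁ h₂ =>
    exact union_subset_union (h₁.trans subset_union_right) h₂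
  | loop B hB S h => exact h.trans subset_union_right
  | block xs t S h => exact sdiff_subset.trans (h.trans subset_union_right)

/-- The variables that occur in the declarations. -/
def declVars (D : Decls L V ar) : Set V :=
  ⋃ P, range (D.formals P) ∪ (D.body P).vars

theorem changeDecls_subset (D : Decls L V ar) : changeDecls D ⊆ declVars D :=
  iUnion_mono fun _ => (changeWith_empty_subset_vars _).trans subset_union_right

theorem range_formals_subset (D : Decls L V ar) (P : Proc) : range (D.formals P) ⊆ declVars D :=
  subset_union_left.trans (subset_iUnion (fun P => range (D.formals P) ∪ (D.body P).vars) P)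

theorem vars_body_subset (D : Decls L V ar) (P : Proc) : (D.body P).vars ⊆ declVars D :=
  subset_union_right.trans (subset_iUnion (fun P => range (D.formals P) ∪ (D.body P).vars) P)

theorem progVars_eq (D : Decls L V ar) (S : Stmt L V ar) : progVars D S = declVars D ∪ S.vars := rfl

theorem change_subset_progVars (D : Decls L V ar) (S : Stmt L V ar) :
    change D S ⊆ progVars D S :=
  (changeWith_subset_union _ _).trans <| union_subset
    ((changeWith_empty_subset_vars S).trans subset_union_right)
    (iUnion_subset fun _ => (sdiff_subset.trans (changeDecls_subset D)).trans subset_union_left)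

theorem change_call_subset (D : Decls L V ar) (P : Proc) (t : Fin (ar P) → L.Term V) :
    change D (.call P t) ⊆ declVars D :=
  sdiff_subset.trans (changeDecls_subset D)

theorem vars_finite (S : Stmt L V ar) : S.vars.Finite := by
  induction S with
  | skip => exact finite_empty
  | assign xs t => exact (finite_range _).union (termVars_finite t)
  | call P t => exact termVars_finite t
  | seq S₁ S₂ h₁ h₂ => exact h₁.union h₂
  | cond B hB S₁ S₂ h₁ h₂ => exact ((free_finite B).union h₁).union h₂
  | loop B hB S h => exact (free_finite B).union h
  | block xs t S h => exact ((finite_range _).union (termVars_finite t)).union h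

theorem declVars_finite [Finite Proc] (D : Decls L V ar) : (declVars D).Finite :=
  finite_iUnion fun _ => (finite_range _).union (vars_finite _)

theorem progVars_finite [Finite Proc] (D : Decls L V ar) (S : Stmt L V ar) :
    (progVars D S).Finite :=
  (declVars_finite D).union (vars_finite S)

variable [L.Structure M] {D : Decls L V ar}

/-- Every test and every assigned expression reads only variables in `X`, so the run can be copied
step by step. Inlined bodies stay within `X` because it contains the variables of the declarations.
-/
theorem Exec.exists_eqOn {S : Stmt L V ar} {σ τ : V → M} (h : Exec D S σ τ) {X : Set V}
    (hX : progVars D S ⊆ X) {σ' : V → M} (hσ : EqOn σ σ' X) :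
    ∃ τ', Exec D S σ' τ' ∧ EqOn τ τ' X := by
  have hD : declVars D ⊆ X := subset_union_left.trans hX
  replace hX : S.vars ⊆ X := subset_union_right.trans hX
  have hterms {n : ℕ} {t : Fin n → L.Term V} {σ σ' : V → M} (ht : termVars t ⊆ X)
      (hσ : EqOn σ σ' X) : (fun i => (t i).realize σ) = fun i => (t i).realize σ' :=
    funext fun i => term_realize_congr
      (hσ.mono ((subset_iUnion (fun i => ((t i).varFinset : Set V)) i).trans ht))
  induction h generalizing σ' with
  | skip => exact ⟨σ', .skip _, hσ⟩
  | assign xs t σ =>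
    exact ⟨_, .assign xs t σ', update_eqOn hσ (hterms (subset_union_right.trans hX) hσ)⟩
  | @call P t σ τ h ih =>
    obtain ⟨τ', h', hτ⟩ := ih hσ (union_subset (union_subset
      ((range_formals_subset D P).trans hD) hX) ((vars_body_subset D P).trans hD))
    exact ⟨τ', .call h', hτ⟩
  | seq h₁ h₂ ih₁ ih₂ =>
    obtain ⟨ρ', h₁', hρ⟩ := ih₁ hσ (subset_union_left.trans hX)
    obtain ⟨τ', h₂', hτ⟩ := ih₂ hρ (subset_union_right.trans hX)
    exact ⟨τ', .seq h₁' h₂', hτ⟩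
  | condTrue hB h ih =>
    have hfB := realize_congr_of_eqOn_free
      (hσ.mono ((subset_union_left.trans subset_union_left).trans hX))
    obtain ⟨τ', h', hτ⟩ := ih hσ ((subset_union_right.trans subset_union_left).trans hX)
    exact ⟨τ', .condTrue (hfB.1 hB) h', hτ⟩
  | condFalse hB h ih =>
    have hfB := realize_congr_of_eqOn_free
      (hσ.mono ((subset_union_left.trans subset_union_left).trans hX))
    obtain ⟨τ', h', hτ⟩ := ih hσ (subset_union_right.trans hX)
    exact ⟨τ', .condFalse (fun h => hB (hfB.2 h)) h', hτ⟩
  | loopTrue hB h₁ h₂ ih₁ ih₂ =>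
    have hfB := realize_congr_of_eqOn_free (hσ.mono (subset_union_left.trans hX))
    obtain ⟨ρ', h₁', hρ⟩ := ih₁ hσ (subset_union_right.trans hX)
    obtain ⟨τ', h₂', hτ⟩ := ih₂ hρ hX
    exact ⟨τ', .loopTrue (hfB.1 hB) h₁' h₂', hτ⟩
  | loopFalse hB =>
    have hfB := realize_congr_of_eqOn_free (hσ.mono (subset_union_left.trans hX))
    exact ⟨σ', .loopFalse fun h => hB (hfB.2 h), hσ⟩
  | block h ih =>
    obtain ⟨τ', h', hτ⟩ := ih hσ (union_subset (subset_union_left.trans hX)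
      (subset_union_right.trans hX))
    refine ⟨_, .block h', update_eqOn hτ (funext fun i => hσ ?_)⟩
    exact hX (Or.inl (Or.inl ⟨i, rfl⟩))

end ProgramLemmas

/-! ### Definability of loop invariants -/

section LoopInvariants

variable {L : FirstOrder.Language.{u, v}} {V : Type w} {Proc : Type x} {ar : Proc → ℕ} {M : Type y}
variable [L.Structure M] {D : Decls L V ar}

theorem valid_iff {p q : L.Formula V} {S : Stmt L V ar} :
    Valid M D ⟨p, S, q⟩ ↔ ∀ σ τ : V → M, p.Realize σ → Exec D S σ τ → q.Realize τ :=
  ⟨fun h _ _ hp he => h ⟨_, hp, he⟩, fun h _ ⟨_, hp, he⟩ => h _ _ hp he⟩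

/-- The states at the head of a loop with guard `B` and body `S` that are reached from a state. -/
def LoopReach (D : Decls L V ar) (B : L.Formula V) (S : Stmt L V ar) : (V → M) → (V → M) → Prop :=
  Relation.ReflTransGen fun σ ρ => B.Realize σ ∧ Exec D S σ ρ

theorem LoopReach.of_exec {B : L.Formula V} {hB : BoundedFormula.IsQF B} {S : Stmt L V ar}
    {σ τ : V → M} (h : Exec D (.loop B hB S) σ τ) : LoopReach D B S σ τ := by
  generalize hS : Stmt.loop B hB S = S' at h
  induction h with
  | loopTrue hσ h₁ h₂ ih₁ ih₂ =>
    cases hS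
    exact .head ⟨hσ, h₁⟩ (ih₂ rfl)
  | loopFalse => exact .refl
  | _ => cases hS

theorem LoopReach.exec {B : L.Formula V} (hB : BoundedFormula.IsQF B) {S : Stmt L V ar}
    {σ τ : V → M} (h : LoopReach D B S σ τ) (hτ : ¬ B.Realize τ) : Exec D (.loop B hB S) σ τ := by
  induction h using Relation.ReflTransGen.head_induction_on with
  | refl => exact .loopFalse hτ
  | head h _ ih => exact .loopTrue h.1 h.2 ih

theorem LoopReach.mono {B B' : L.Formula V} {S : Stmt L V ar} {σ τ : V → M}
    (hB : ∀ ρ : V → M, B.Realize ρ → B'.Realize ρ) (h : LoopReach D B S σ τ) :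
    LoopReach D B' S σ τ :=
  Relation.ReflTransGen.mono (fun _ _ h => ⟨hB _ h.1, h.2⟩) _ _ h

theorem LoopReach.eq_of_notMem_change {B : L.Formula V} {S : Stmt L V ar} {σ τ : V → M}
    (h : LoopReach D B S σ τ) : ∀ a ∉ change D S, τ a = σ a := by
  induction h with
  | refl => exact fun _ _ => rfl
  | tail _ h ih => exact fun a ha => (h.2.eq_of_notMem_change a ha).trans (ih a ha)

variable [DecidableEq V]

theorem LoopReach.exists_eqOn {B : L.Formula V} {S : Stmt L V ar} {σ τ : V → M}
    (h : LoopReach D B S σ τ) {X : Set V} (hB : free B ⊆ X) (hX : progVars D S ⊆ X) {σ' : V → M}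
    (hσ : EqOn σ σ' X) : ∃ τ', LoopReach D B S σ' τ' ∧ EqOn τ τ' X := by
  induction h with
  | refl => exact ⟨σ', .refl, hσ⟩
  | tail _ h ih =>
    obtain ⟨ρ', hρ', hρ⟩ := ih
    obtain ⟨τ', hτ', hτ⟩ := h.2.exists_eqOn hX hρ
    exact ⟨τ', hρ'.tail ⟨(realize_congr_of_eqOn_free (hρ.mono hB)).1 h.1, hτ'⟩, hτ⟩

/-- Reachability by iterations of a loop only depends on the values of the variables of the loop,
so that the variables `z̄` that do not occur in it may be given arbitrary values. -/
theorem LoopReach.update {B : L.Formula V} {S : Stmt L V ar} {σ τ : V → M}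
    (h : LoopReach D B S σ τ) {n : ℕ} {zs : Fin n ↪ V} (hB : Disjoint (range zs) (free B))
    (hS : Disjoint (range zs) (progVars D S)) (d : Fin n → M) :
    LoopReach D B S (update σ zs d) (update τ zs d) := by
  obtain ⟨τ', hτ', hτ⟩ := h.exists_eqOn (subset_compl_iff_disjoint_left.2 hB)
    (subset_compl_iff_disjoint_left.2 hS) (σ' := CBV.update σ zs d)
    fun a ha => (update_of_notMem _ _ _ ha).symm
  -- Off `zs` the two runs agree; on `zs` the copied run keeps the values `d`, since variables not
  -- occurring in the body are not changed.
  convert hτ'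
  funext a
  by_cases ha : a ∈ range zs
  · rw [hτ'.eq_of_notMem_change a fun h =>
      disjoint_left.1 hS ha (change_subset_progVars D S h)]
    obtain ⟨i, rfl⟩ := ha
    simp
  · rw [update_of_notMem _ _ _ ha, hτ ha]

/-- Expressiveness for the loop itself describes only exit states. To catch intermediate ones, a
target is guessed in fresh variables `zs` and the guard is strengthened by `xs ≠ zs`: the modified
loop can then stop at exactly the guessed state. Quantifying `zs` away gives the reachable set. -/
theorem exists_definable_loopReach [Infinite V] [Finite Proc] (hexp : Expressive M D)
    (p B : L.Formula V) (hB : BoundedFormula.IsQF B) (S : Stmt L V ar) :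
    ∃ r : L.Formula V, ∀ τ : V → M,
      r.Realize τ ↔ ∃ σ : V → M, p.Realize σ ∧ LoopReach D B S σ τ := by
  have hXfin := progVars_finite D (.loop B hB S)
  obtain ⟨n, xs, hxs⟩ := exists_enumeration hXfin
  obtain ⟨fr, hfr⟩ := exists_fresh_embedding (hXfin.union (free_finite p))
  set zs : Fin n ↪ V := xs.trans fr
  have hz : Disjoint (range zs) (progVars D (.loop B hB S) ∪ free p) :=
    hfr.mono_left (range_comp_subset_range xs fr)
  have hzB : Disjoint (range zs) (free B) :=
    hz.mono_right fun a ha => Or.inl (Or.inr (Or.inl ha))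
  have hzS : Disjoint (range zs) (progVars D S) :=
    hz.mono_right fun a ha => Or.inl (ha.imp_right Or.inr)
  have hzc : ∀ i, fr (xs i) ∉ change D S := fun i hi =>
    disjoint_left.1 hzS ⟨i, rfl⟩ (change_subset_progVars D S hi)
  have hupd (σ : V → M) (d : Fin n → M) (hp : p.Realize σ) : p.Realize (update σ zs d) :=
    (realize_congr_of_eqOn_free fun a ha => (update_of_notMem _ _ _
      (disjoint_right.1 hz (Or.inr ha))).symm).1 hp
  obtain ⟨φ, hφ⟩ := hexp p
    (.loop (B ⊓ (eqs L xs fr).not) (hB.inf (isQF_eqs xs fr).not) S)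
  have hφ (τ : V → M) : φ.Realize τ ↔ _ := Set.ext_iff.1 hφ τ
  refine ⟨existsVars zs (φ ⊓ eqs L xs fr), fun τ => ?_⟩
  rw [realize_existsVars]
  constructor
  · rintro ⟨d, hd⟩
    obtain ⟨σ, hσ, he⟩ := (hφ _).1 (Formula.realize_inf.1 hd).1
    have hreach := (LoopReach.of_exec he).mono fun ρ h => (Formula.realize_inf.1 h).1
    -- The guess is undone: `zs` receives its values in `τ` along the whole run.
    have := hreach.update hzB hzS fun i => τ (zs i)
    refine ⟨_, hupd σ (fun i => τ (zs i)) hσ, ?_⟩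
    convert this
    funext a
    by_cases ha : a ∈ range zs
    · obtain ⟨i, rfl⟩ := ha
      simp
    · simp [update_of_notMem _ _ _ ha]
  · rintro ⟨σ, hp, hreach⟩
    refine ⟨fun i => τ (xs i), Formula.realize_inf.2 ?_⟩
    replace hreach := hreach.update hzB hzS fun i => τ (xs i)
    have heqs : (eqs L xs fr).Realize (update τ zs fun i => τ (xs i)) := by
      rw [realize_eqs]
      intro i
      change _ = update τ zs _ (zs i)
      rw [update_apply_mem, update_of_notMem]
      exact disjoint_right.1 hz (Or.inl (hxs ▸ mem_range_self i))
    refine ⟨(hφ _).2 ⟨update σ zs fun i => τ (xs i), hupd σ _ hp, ?_⟩, heqs⟩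
    generalize (update σ zs fun i => τ (xs i)) = σ₁ at hreach ⊢
    induction hreach using Relation.ReflTransGen.head_induction_on with
    | refl => exact .loopFalse fun h => (Formula.realize_inf.1 h).2 heqs
    | @head σ' ρ h hrest ih =>
      -- If the modified loop stops early, it is already at the target: `zs` is never changed, so it
      -- fixes `xs`, and no other variable changes.
      by_cases hσ' : (eqs L xs fr).Realize σ'
      · have : σ' = update τ zs fun i => τ (xs i) := by
          have hframe := LoopReach.eq_of_notMem_change (.head h hrest)
          funext a
          by_cases ha : a ∈ range xs
          · obtain ⟨i, rfl⟩ := ha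
            rw [(realize_eqs xs fr).1 hσ' i, (realize_eqs xs fr).1 heqs i, hframe _ (hzc i)]
          · refine (hframe a fun h => ha ?_).symm
            rw [hxs]
            exact change_subset_progVars D (.loop B hB S) h
        rw [← this] at heqs ⊢
        exact .loopFalse fun h => (Formula.realize_inf.1 h).2 heqs
      · exact .loopTrue (Formula.realize_inf.2 ⟨h.1, hσ'⟩) h.2 ih

end LoopInvariants

/-! ### Completeness relative to procedure calls -/

section Completeness

variable {L : FirstOrder.Language.{u, v}} {V : Type w} {Proc : Type x} {ar : Proc → ℕ} {M : Type y}
variable [L.Structure M] {D : Decls L V ar} [DecidableEq V] {Φ : Set (Triple L V ar)}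

theorem DerivesBasic.of_imp {p p₁ q₁ q : L.Formula V} {S : Stmt L V ar}
    (h : DerivesBasic M D Φ ⟨p₁, S, q₁⟩) (hp : ∀ σ : V → M, p.Realize σ → p₁.Realize σ)
    (hq : ∀ σ : V → M, q₁.Realize σ → q.Realize σ) : DerivesBasic M D Φ ⟨p, S, q⟩ :=
  .consequence (eq_univ_of_forall fun σ => Formula.realize_imp.2 (hp σ)) h
    (eq_univ_of_forall fun σ => Formula.realize_imp.2 (hq σ))

/-- The form in which ∃-INTRODUCTION is used: auxiliary variables may be given convenient initial
values. -/
theorem DerivesBasic.of_exists_update {p r q : L.Formula V} {S : Stmt L V ar} {n : ℕ}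
    {zs : Fin n ↪ V} (hz : Disjoint (range zs) (progVars D S ∪ free q))
    (h : DerivesBasic M D Φ ⟨r, S, q⟩)
    (hp : ∀ σ : V → M, p.Realize σ → ∃ d, r.Realize (update σ zs d)) :
    DerivesBasic M D Φ ⟨p, S, q⟩ :=
  (DerivesBasic.existsIntro zs hz h).of_imp (fun σ hσ => (realize_existsVars zs r).2 (hp σ hσ))
    fun _ => id

theorem derivesBasic_assign {n : ℕ} {xs : Fin n ↪ V} {t : Fin n → L.Term V} {p q : L.Formula V}
    (h : Valid M D ⟨p, .assign xs t, q⟩) : DerivesBasic M D Φ ⟨p, .assign xs t, q⟩ :=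
  (DerivesBasic.assign xs t q).of_imp
    (fun σ hσ => (realize_subst q xs t).2 (valid_iff.1 h σ _ hσ (.assign xs t σ))) fun _ => id

theorem derivesBasic_seq (hexp : Expressive M D) {S₁ S₂ : Stmt L V ar} {p q : L.Formula V}
    (h₁ : ∀ r, Valid M D ⟨p, S₁, r⟩ → DerivesBasic M D Φ ⟨p, S₁, r⟩)
    (h₂ : ∀ r, Valid M D ⟨r, S₂, q⟩ → DerivesBasic M D Φ ⟨r, S₂, q⟩)
    (h : Valid M D ⟨p, .seq S₁ S₂, q⟩) : DerivesBasic M D Φ ⟨p, .seq S₁ S₂, q⟩ := by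
  -- The intermediate assertion is the strongest postcondition of `S₁`.
  obtain ⟨r, hr⟩ := hexp p S₁
  refine .seq (h₁ r hr.ge) (h₂ r (valid_iff.2 fun ρ τ hρ he => ?_))
  obtain ⟨σ, hσ, he₁⟩ := hr.le hρ
  exact valid_iff.1 h σ τ hσ (.seq he₁ he)

theorem derivesBasic_loop [Infinite V] [Finite Proc] (hexp : Expressive M D) {B : L.Formula V}
    {hB : BoundedFormula.IsQF B} {S : Stmt L V ar} {p q : L.Formula V}
    (hS : ∀ p q, Valid M D ⟨p, S, q⟩ → DerivesBasic M D Φ ⟨p, S, q⟩)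
    (h : Valid M D ⟨p, .loop B hB S, q⟩) : DerivesBasic M D Φ ⟨p, .loop B hB S, q⟩ := by
  obtain ⟨r, hr⟩ := exists_definable_loopReach hexp p B hB S
  refine (DerivesBasic.loop (p := r) (hS _ _ (valid_iff.2 fun ρ τ hρ he => ?_))).of_imp
    (fun σ hσ => (hr σ).2 ⟨σ, hσ, .refl⟩) fun τ hτ => ?_
  · obtain ⟨hρ, hBρ⟩ := Formula.realize_inf.1 hρ
    obtain ⟨σ, hσ, hreach⟩ := (hr ρ).1 hρ
    exact (hr τ).2 ⟨σ, hσ, hreach.tail ⟨hBρ, he⟩⟩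
  · obtain ⟨hτ, hBτ⟩ := Formula.realize_inf.1 hτ
    obtain ⟨σ, hσ, hreach⟩ := (hr τ).1 hτ
    exact valid_iff.1 h σ τ hσ (hreach.exec hB hBτ)

/-- BLOCK forbids `xs` in the postcondition, so `q` is rewritten to speak of fresh `zs` that hold
the initial values of `xs`. The block changes neither list, so INVARIANCE carries `xs = zs` across
it and turns the rewritten postcondition back into `q`. -/
theorem derivesBasic_block [Infinite V] [Finite Proc] (hexp : Expressive M D) {n : ℕ}
    {xs : Fin n ↪ V} {t : Fin n → L.Term V} {S : Stmt L V ar} {p q : L.Formula V}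
    (hS : ∀ p q, Valid M D ⟨p, S, q⟩ → DerivesBasic M D Φ ⟨p, S, q⟩)
    (h : Valid M D ⟨p, .block xs t S, q⟩) : DerivesBasic M D Φ ⟨p, .block xs t S, q⟩ := by
  obtain ⟨fr, hfr⟩ := exists_fresh_embedding
    (((progVars_finite D (.block xs t S)).union (free_finite p)).union (free_finite q))
  set zs : Fin n ↪ V := xs.trans fr
  have hz : Disjoint (range zs) (progVars D (.block xs t S) ∪ free p ∪ free q) :=
    hfr.mono_left (range_comp_subset_range xs fr)
  have hzx : Disjoint (range zs) (range xs) :=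
    hz.mono_right fun a ha => Or.inl (Or.inl (Or.inr (Or.inl (Or.inl ha))))
  have hxq : Disjoint (range xs) (free (subst q xs fun i => .var (zs i))) := by
    refine Disjoint.mono_right (free_subst q xs _) ?_
    rw [termVars_var]
    exact disjoint_sdiff_right.union_right hzx.symm
  have hchange : Disjoint (free (eqs L xs fr)) (change D (.block xs t S)) := by
    refine Disjoint.mono_left (free_eqs xs fr) (disjoint_union_left.2 ⟨disjoint_sdiff_right, ?_⟩)
    refine Disjoint.mono ?_ ((change_subset_progVars D _).trans
      (subset_union_left.trans subset_union_left)) hz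
    rintro _ ⟨_, ⟨i, rfl⟩, rfl⟩
    exact ⟨i, rfl⟩
  have hseq : DerivesBasic M D Φ
      ⟨p ⊓ eqs L xs fr, .seq (.assign xs t) S, subst q xs fun i => .var (zs i)⟩ := by
    refine derivesBasic_seq hexp (fun r => derivesBasic_assign) (fun r => hS r _)
      (valid_iff.2 fun σ τ hσ he => ?_)
    obtain ⟨hp, heqs⟩ := Formula.realize_inf.1 hσ
    rw [realize_eqs] at heqs
    rw [realize_subst]
    -- The block ends by restoring `xs` from `σ`, and these values equal those of `zs` in `τ`.
    convert valid_iff.1 h σ _ hp (.block he) using 3 with i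
    rw [Term.realize_var, heqs i]
    refine he.eq_of_notMem_change _ fun hc => ?_
    rcases hc with hc | hc
    · exact disjoint_left.1 hzx ⟨i, rfl⟩ hc
    · exact disjoint_left.1 hz ⟨i, rfl⟩ (Or.inl (Or.inl (Or.imp_right Or.inr
        (change_subset_progVars D S hc))))
  refine DerivesBasic.of_exists_update (zs := zs) (r := eqs L xs fr ⊓ (p ⊓ eqs L xs fr))
    (hz.mono_right (union_subset_union_left _ subset_union_left))
    ((DerivesBasic.invariance _ hchange (.block hxq hseq)).of_imp (fun _ => id) fun τ hτ => ?_)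
    fun σ hσ => ⟨fun i => σ (xs i), ?_⟩
  · obtain ⟨heqs, hq⟩ := Formula.realize_inf.1 hτ
    rw [realize_eqs] at heqs
    rw [realize_subst] at hq
    convert hq
    exact (update_self τ xs).symm.trans (congrArg _ (funext heqs))
  · have heqs : (eqs L xs fr).Realize (update σ zs fun i => σ (xs i)) := by
      rw [realize_eqs]
      intro i
      change _ = update σ zs _ (zs i)
      rw [update_apply_mem, update_of_notMem]
      exact disjoint_right.1 hzx ⟨i, rfl⟩
    refine Formula.realize_inf.2 ⟨heqs, Formula.realize_inf.2 ⟨?_, heqs⟩⟩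
    exact (realize_congr_of_eqOn_free fun a ha => (update_of_notMem _ _ _
      (disjoint_right.1 hz (Or.inl (Or.inr ha)))).symm).1 hσ

/-- Completeness of the rules other than RECURSION relative to the true correctness formulas for
procedure calls. -/
theorem derivesBasic_of_valid [Infinite V] [Finite Proc] (hexp : Expressive M D)
    (hcall : ∀ P t p q, Valid M D ⟨p, .call P t, q⟩ → DerivesBasic M D Φ ⟨p, .call P t, q⟩)
    (S : Stmt L V ar) (p q : L.Formula V) (h : Valid M D ⟨p, S, q⟩) :
    DerivesBasic M D Φ ⟨p, S, q⟩ := by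
  induction S generalizing p q with
  | skip =>
    exact (DerivesBasic.skip p).of_imp (fun _ => id) fun σ hσ => valid_iff.1 h σ σ hσ (.skip σ)
  | assign xs t => exact derivesBasic_assign h
  | call P t => exact hcall P t p q h
  | seq S₁ S₂ h₁ h₂ => exact derivesBasic_seq hexp (fun r => h₁ p r) (fun r => h₂ r q) h
  | cond B hB S₁ S₂ h₁ h₂ =>
    refine .cond (h₁ _ _ (valid_iff.2 fun σ τ hσ he => ?_))
      (h₂ _ _ (valid_iff.2 fun σ τ hσ he => ?_))
    · obtain ⟨hp, hBσ⟩ := Formula.realize_inf.1 hσ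
      exact valid_iff.1 h σ τ hp (.condTrue hBσ he)
    · obtain ⟨hp, hBσ⟩ := Formula.realize_inf.1 hσ
      exact valid_iff.1 h σ τ hp (.condFalse hBσ he)
  | loop B hB S hS => exact derivesBasic_loop hexp hS h
  | block xs t S hS => exact derivesBasic_block hexp hS h

end Completeness

/-! ### Most general formulas for procedures -/

section Calls

variable {L : FirstOrder.Language.{u, v}} {V : Type w} {Proc : Type x} {ar : Proc → ℕ} {M : Type y}
variable [L.Structure M] {D : Decls L V ar}

theorem exec_call_iff {P : Proc} {t : Fin (ar P) → L.Term V} {σ τ : V → M} :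
    Exec D (.call P t) σ τ ↔
      ∃ ρ, Exec D (D.body P) (update σ (D.formals P) fun i => (t i).realize σ) ρ ∧
        τ = update ρ (D.formals P) fun i => σ (D.formals P i) := by
  constructor
  · intro h
    cases h with
    | call h =>
      cases h with
      | block h =>
        cases h with
        | seq h₁ h₂ =>
          cases h₁
          exact ⟨_, h₂, rfl⟩
  · rintro ⟨ρ, h, rfl⟩
    exact .call (.block (.seq (.assign _ _ _) h))

theorem exec_genericCall_iff {P : Proc} {σ τ : V → M} :
    Exec D (genericCall D P) σ τ ↔
      ∃ ρ, Exec D (D.body P) σ ρ ∧ τ = update ρ (D.formals P) fun i => σ (D.formals P i) := by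
  rw [genericCall, exec_call_iff]
  simp only [Term.realize_var, update_self]

/-- The postcondition of the most general correctness formula for a procedure `P` whose strongest
postcondition is `φ`: the values of the formal parameters are those of their fresh copies. -/
noncomputable def genericPost (D : Decls L V ar) (P : Proc) (φ : L.Formula V) (fr : V → V) :
    L.Formula V :=
  subst φ (D.formals P) fun i => .var (fr (D.formals P i))

/-- The body leaves the copies alone, so resetting `ū` from them is the same as restoring the
initial values of `ū`, which is all that a generic call does after the body. -/
theorem valid_body_genericPost [DecidableEq V] {n : ℕ} {xs : Fin n ↪ V}
    (hxs : range xs = declVars D) {fr : V → V} (hfr : Disjoint (range fr) (declVars D)) {P : Proc}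
    {φ : L.Formula V} (hφ : meaning M φ = sp M D (eqs L xs fr) (genericCall D P)) :
    Valid M D ⟨eqs L xs fr, D.body P, genericPost D P φ fr⟩ := by
  refine valid_iff.2 fun σ τ hσ he => ?_
  rw [genericPost, realize_subst]
  refine hφ.ge ⟨σ, hσ, exec_genericCall_iff.2 ⟨τ, he, congrArg _ (funext fun i => ?_)⟩⟩
  rw [Term.realize_var, he.eq_of_notMem_change _ fun h => disjoint_left.1 hfr (mem_range_self _)
    (changeDecls_subset D (change_body_subset D P h))]
  obtain ⟨j, hj⟩ : D.formals P i ∈ range xs := hxs ▸ range_formals_subset D P (mem_range_self i)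
  rw [← hj, (realize_eqs xs fr).1 hσ j]

variable [DecidableEq V] {Φ : Set (Triple L V ar)}

theorem disjoint_free_genericPost {fr : V → V} (hfr : Disjoint (range fr) (declVars D)) (P : Proc)
    (φ : L.Formula V) : Disjoint (range (D.formals P)) (free (genericPost D P φ fr)) := by
  refine Disjoint.mono_right (free_subst φ (D.formals P) _) ?_
  rw [termVars_var]
  exact disjoint_sdiff_right.union_right
    (hfr.mono (range_comp_subset_range _ fr) (range_formals_subset D P)).symm

/-- All true correctness formulas for calls of `P` follow from the most general one. -/
theorem derivesBasic_call [Infinite V] [Finite Proc] {n : ℕ} {xs : Fin n ↪ V}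
    (hxs : range xs = declVars D) {fr : V ↪ V} (hfr : Disjoint (range fr) (declVars D)) {P : Proc}
    {φ : L.Formula V} (hφ : meaning M φ = sp M D (eqs L xs fr) (genericCall D P))
    (hΦ : ⟨eqs L xs fr, genericCall D P, genericPost D P φ fr⟩ ∈ Φ)
    (t : Fin (ar P) → L.Term V) (p q : L.Formula V) (h : Valid M D ⟨p, .call P t, q⟩) :
    DerivesBasic M D Φ ⟨p, .call P t, q⟩ := by
  have hxD (i : Fin n) : xs i ∈ declVars D := hxs ▸ mem_range_self i
  have hDx {a : V} (ha : a ∈ declVars D) : ∃ i, xs i = a := by rwa [← hxs] at ha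
  have hus := range_formals_subset D P
  -- A second family of copies is needed, since `t`, `p` and `q` may mention the variables `fr (xs
  -- i)`.
  obtain ⟨gr, hgr⟩ := exists_fresh_embedding
    (((progVars_finite D (.call P t)).union (free_finite p)).union (free_finite q))
  have hgrD (a : V) : gr a ∉ declVars D := fun h =>
    disjoint_left.1 hgr (mem_range_self a) (Or.inl (Or.inl (Or.inl h)))
  have hfrD (a : V) : fr a ∉ declVars D := disjoint_left.1 hfr (mem_range_self a)
  have hysub : range (xs.trans gr) ⊆ range gr := range_comp_subset_range xs gr
  have hy {a : V} (ha : a ∈ progVars D (.call P t) ∪ free p ∪ free q) :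
      a ∉ range (xs.trans gr) := disjoint_right.1 (hgr.mono_left hysub) ha
  set pre : L.Formula V := subst (subst (eqs L xs fr) (xs.trans fr) fun i => .var (gr (xs i)))
    (D.formals P) t with hpre
  set post : L.Formula V :=
    subst (genericPost D P φ fr) (xs.trans fr) fun i => .var (gr (xs i)) with hpost
  have realize_pre (σ : V → M) : pre.Realize σ ↔
      ∀ i, update σ (D.formals P) (fun j => (t j).realize σ) (xs i) = σ (gr (xs i)) := by
    rw [hpre, realize_subst, realize_subst, realize_eqs]
    refine forall_congr' fun i => ?_
    rw [update_of_notMem _ (xs.trans fr) _ (a := xs i)]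
    · change _ = update _ (xs.trans fr) _ ((xs.trans fr) i) ↔ _
      rw [update_apply_mem, Term.realize_var,
        update_of_notMem _ (D.formals P) _ (fun h => hgrD (xs i) (hus h))]
    · rintro ⟨j, hj⟩
      exact hfrD (xs j) (hj ▸ hxD i)
  have hcall : DerivesBasic M D Φ ⟨pre, .call P t, post⟩ := by
    -- The renaming precedes the instantiation of the parameters: SUBSTITUTION requires that the
    -- renamed variables do not occur in the call, which is certain only for the generic call.
    refine .procedureCall t ?_ (.substitution (xs.trans fr) (fun i => gr (xs i)) ?_ ?_ (.hyp hΦ))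
    · refine Disjoint.mono_right (free_subst _ _ _) ?_
      rw [termVars_var]
      refine Disjoint.union_right ((disjoint_free_genericPost hfr P φ).mono_right sdiff_subset) ?_
      rw [Set.disjoint_right]
      rintro _ ⟨i, rfl⟩ hi
      exact hgrD _ (hus hi)
    · rw [progVars_eq, genericCall, Stmt.vars, termVars_var]
      exact hfr.mono (range_comp_subset_range xs fr) (union_subset Subset.rfl hus)
    · rw [Set.disjoint_left]
      rintro _ ⟨i, rfl⟩ hi
      exact hgrD _ (change_call_subset D P _ hi)
  obtain ⟨m, cs, hcs⟩ := exists_enumeration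
    ((declVars_finite D).subset (change_call_subset D P t))
  have hcsD (i : Fin m) : cs i ∈ declVars D :=
    change_call_subset D P t (hcs ▸ mem_range_self i)
  have hcsu {a : V} (ha : a ∈ range (D.formals P)) : a ∉ range cs := by
    rw [hcs]
    exact fun h => h.2 ha
  -- With the changeable variables `cs` replaced by their copies, `p ⊓ pre` still describes the
  -- initial state after the call.
  have hinv := DerivesBasic.invariance (subst (p ⊓ pre) cs fun i => .var (gr (cs i))) (by
    rw [← hcs]
    refine Disjoint.mono_left (free_subst _ _ _) ?_
    rw [termVars_var]
    refine Disjoint.union_left disjoint_sdiff_left ?_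
    rw [Set.disjoint_left]
    rintro _ ⟨i, rfl⟩ ⟨j, hj⟩
    exact hgrD (cs i) ((show cs j = gr (cs i) from hj) ▸ hcsD j)) hcall
  refine DerivesBasic.of_exists_update (zs := xs.trans gr) ?_
    (hinv.of_imp (q := q) (fun _ => id) fun τ hτ => ?_) fun σ hσ => ?_
  · exact disjoint_right.2 fun a ha => hy (ha.imp_left Or.inl)
  · obtain ⟨hr, hpostτ⟩ := Formula.realize_inf.1 hτ
    rw [realize_subst, Formula.realize_inf, realize_pre] at hr
    simp only [Term.realize_var] at hr
    -- The initial state is reconstructed from the final state `τ`; it remains to show that the call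
    -- leads from `σ` to `τ`.
    set σ := update τ cs fun i => τ (gr (cs i)) with hσ
    obtain ⟨hp, hr⟩ := hr
    rw [hpost, realize_subst, genericPost, realize_subst] at hpostτ
    simp only [Term.realize_var] at hpostτ
    set τ₂ := update τ (xs.trans fr) fun i => τ (gr (xs i)) with hτ₂
    obtain ⟨σ', hσ', he⟩ := hφ.le hpostτ
    obtain ⟨ρ, hbody, heq⟩ := exec_genericCall_iff.1 he
    have hστ {a : V} (ha : a ∉ range cs) : σ a = τ a := update_of_notMem _ _ _ ha
    have hρ {a : V} (ha : a ∉ range (D.formals P)) : ρ a = τ₂ a := by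
      have := congrFun heq a
      rwa [update_of_notMem _ _ _ ha, update_of_notMem _ _ _ ha, eq_comm] at this
    -- The run behind `φ` starts, on the variables of the declarations, in the state in which the
    -- actual call enters the body: both states agree there with the values of `gr xs` in `τ`.
    have hagree : EqOn σ' (update σ (D.formals P) fun j => (t j).realize σ) (declVars D) := by
      intro a ha
      obtain ⟨i, rfl⟩ := hDx ha
      rw [hr i, hστ fun ⟨j, hj⟩ => hgrD (xs i) (hj ▸ hcsD j), (realize_eqs xs fr).1 hσ' i,
        ← hbody.eq_of_notMem_change _ fun h =>
          hfrD (xs i) (changeDecls_subset D (change_body_subset D P h)),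
        hρ fun h => hfrD (xs i) (hus h)]
      exact update_apply_mem τ (xs.trans fr) _ i
    obtain ⟨ρ', hbody', hρρ'⟩ := hbody.exists_eqOn
      (union_subset Subset.rfl (vars_body_subset D P)) hagree
    refine valid_iff.1 h σ τ hp (exec_call_iff.2 ⟨ρ', hbody', ?_⟩)
    funext a
    by_cases hau : a ∈ range (D.formals P)
    · obtain ⟨i, rfl⟩ := hau
      rw [update_apply_mem, hστ (hcsu (mem_range_self i))]
    rw [update_of_notMem _ _ _ hau]
    by_cases haD : a ∈ declVars D
    · rw [← hρρ' haD, hρ hau, hτ₂, update_of_notMem]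
      rintro ⟨j, hj⟩
      exact hfrD (xs j) (hj ▸ haD)
    · rw [hbody'.eq_of_notMem_change _ fun h =>
          haD (changeDecls_subset D (change_body_subset D P h)),
        update_of_notMem _ _ _ hau, hστ]
      rintro ⟨j, hj⟩
      exact haD (hj ▸ hcsD j)
  -- The copies receive the values of `xs` on entry to the body, after the parameters are passed.
  · refine ⟨fun i => update σ (D.formals P) (fun j => (t j).realize σ) (xs i), ?_⟩
    set d := fun i => update σ (D.formals P) (fun j => (t j).realize σ) (xs i) with hd
    set σ₁ := update σ (xs.trans gr) d with hσ₁
    have hσσ₁ : EqOn σ σ₁ (progVars D (.call P t) ∪ free p ∪ free q) := fun a ha =>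
      (update_of_notMem _ _ _ (hy ha)).symm
    have hσ₁y (i : Fin n) : σ₁ (gr (xs i)) = d i := update_apply_mem σ (xs.trans gr) d i
    have hpre₁ : pre.Realize σ₁ := by
      rw [realize_pre]
      intro i
      rw [hσ₁y i]
      refine update_eqOn (fun a ha => (hσσ₁ (Or.inl (Or.inl ha))).symm) (funext fun j => ?_)
        (Or.inl (hxD i))
      refine (term_realize_congr (hσσ₁.mono fun a ha => ?_)).symm
      exact Or.inl (Or.inl (Or.inr (mem_iUnion.2 ⟨j, ha⟩)))
    have hp₁ : p.Realize σ₁ :=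
      (realize_congr_of_eqOn_free fun a ha => hσσ₁ (Or.inl (Or.inr ha))).1 hσ
    refine Formula.realize_inf.2 ⟨?_, hpre₁⟩
    rw [realize_subst]
    -- No variable of `cs` is a formal parameter, so its copy holds its value before the call and
    -- the substitution has no effect initially.
    have : (update σ₁ cs fun i => (Term.var (gr (cs i)) : L.Term V).realize σ₁) = σ₁ := by
      refine Eq.trans (congrArg _ (funext fun i => ?_)) (update_self σ₁ cs)
      obtain ⟨j, hj⟩ := hDx (hcsD i)
      rw [Term.realize_var, ← hj, hσ₁y, hd, ← hσσ₁ (Or.inl (Or.inl (Or.inl (hxD j))))]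
      exact update_of_notMem _ _ _ fun h => hcsu h ⟨i, hj.symm⟩
    rw [this]
    exact Formula.realize_inf.2 ⟨hp₁, hpre₁⟩

end Calls

end CBV

/-! ### The application of RECURSION -/

theorem mainTheorem1 {L : FirstOrder.Language.{u, v}} {V : Type w} [DecidableEq V] [Infinite V]
    {Proc : Type x} [Finite Proc] {ar : Proc → ℕ} (D : CBV.Decls L V ar)
    {M : Type y} [Nonempty M] [L.Structure M] (hexp : CBV.Expressive M D)
    (p : L.Formula V) (S : CBV.Stmt L V ar) (q : L.Formula V)
    (hvalid : CBV.Valid M D ⟨p, S, q⟩) :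
    CBV.Derives M D ∅ ⟨p, S, q⟩ := by
  obtain ⟨n, xs, hxs⟩ := CBV.exists_enumeration (CBV.declVars_finite D)
  obtain ⟨fr, hfr⟩ := CBV.exists_fresh_embedding (CBV.declVars_finite D)
  choose φ hφ using fun P => hexp (CBV.eqs L xs fr) (CBV.genericCall D P)
  -- One set of assumptions serves both the goal and all the bodies. There is no circularity,
  -- because the formulas for the bodies are known to be true semantically.
  have hcomplete := CBV.derivesBasic_of_valid hexp
    (fun P => CBV.derivesBasic_call hxs hfr (hφ P) (Set.mem_range_self P))
  exact .hyp (Or.inr ⟨fun _ => CBV.eqs L xs fr, fun P => CBV.genericPost D P (φ P) fr,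
    fun P => CBV.disjoint_free_genericPost hfr P (φ P), hcomplete S p q hvalid,
    fun P => hcomplete _ _ _ (CBV.valid_body_genericPost hxs hfr (hφ P))⟩)
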